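/- Let $d\ge 1$ and $\mathcal F g(\xi)=(2\pi)^{-d/2}\int_{\mathbb R^d}e^{ix\xi}g(x)\,dx$, extended to tempered distributions. Let $\psi_0\in C_0^\infty(\mathbb R^d)$ with $\psi_0(x)=1$ if $\max_i|x_i|\le 1$ and $\psi_0(x)=0$ if $\max_i|x_i|\ge \frac32$, and let $\varphi_0\in C_0^\infty(\mathbb R)$ with $\varphi_0=1$ on $[-1,1]$ and $\operatorname{supp}\varphi_0\subset[-\frac32,\frac32]$. Put $\psi_j(x)=\psi_0(2^{-j}x)-\psi_0(2^{-j+1}x)$ and $\varphi_j(x)=\varphi_0(2^{-j}x)-\varphi_0(2^{-j+1}x)$ for $j\ge1$, and $\varphi_{\bar k}(x)=\varphi_{k_1}(x_1)\cdots\varphi_{k_d}(x_d)$, $|\bar k|=k_1+\dots+k_d$, for $\bar k\in\mathbb N_0^d$. For $t\in\mathbb R$ and $0<p,q\le\infty$ let $B^t_{p,q}(\mathbb R^d)$ and $S^t_{p,q}B(\mathbb R^d)$ be the spaces of all tempered distributions $f$ on $\mathbb R^d$ for which, respectively, $$\|f|B^t_{p,q}\|=\Big(\sum_{j=0}^\infty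 2^{jtq}\,\|\mathcal F^{-1}[\psi_j\mathcal F f]\,|L_p(\mathbb R^d)\|^q\Big)^{1/q},\qquad \|f|S^t_{p,q}B\|=\Big(\sum_{\bar k\in\mathbb N_0^d}2^{|\bar k|tq}\,\|\mathcal F^{-1}[\varphi_{\bar k}\mathcal F f]\,|L_p(\mathbb R^d)\|^q\Big)^{1/q}$$ is finite (supremum if $q=\infty$). Write $X\hookrightarrow Y$ if $X\subset Y$ and $\|f|Y\|\le C\,\|f|X\|$ for all $f\in X$, with some constant $C$ independent of $f$. **Theorem.** Fix $0<p,q\le\infty$ and $t\in\mathbb R$. Within all spaces $B^{t_0}_{p_0,q_0}(\mathbb R^d)$ ($0<p_0,q_0\le\infty$, $t_0\in\mathbb R$) satisfying $B^{t_0}_{p_0,q_0}(\mathbb R^d)\hookrightarrow S^t_{p,q}B(\mathbb R^d)$ the class $B^{td}_{p,q}(\mathbb R^d)$ is the largest one, in the following sense. 1. For all $0<p_0,q_0\le\infty$ and $t_0\in\mathbb R$: if $B^{t_0}_{p_0,q_0}(\mathbb R^d)\hookrightarrow S^t_{p,q}B(\mathbb R^d)$, then $B^{t_0}_{p_0,q_0}(\mathbb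 R^d)\hookrightarrow B^{td}_{p,q}(\mathbb R^d)$. 2. Consequently, whenever $B^{td}_{p,q}(\mathbb R^d)$ itself belongs to this family, i.e. $B^{td}_{p,q}(\mathbb R^d)\hookrightarrow S^t_{p,q}B(\mathbb R^d)$, it is its largest member: for all $0<p_0,q_0\le\infty$ and $t_0\in\mathbb R$, $B^{t_0}_{p_0,q_0}(\mathbb R^d)\hookrightarrow S^t_{p,q}B(\mathbb R^d)$ if and only if $B^{t_0}_{p_0,q_0}(\mathbb R^d)\hookrightarrow B^{td}_{p,q}(\mathbb R^d)$. -/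

import Mathlib

open MeasureTheory
open scoped ENNReal NNReal SchwartzMap ContDiff

noncomputable section

namespace BesovComparison

/-- The Euclidean space `ℝ^d`. -/
abbrev Rd (d : ℕ) : Type := EuclideanSpace ℝ (Fin d)

/-- Generator of a cubic smooth dyadic decomposition of unity on `ℝ^d`: a smooth function which is
`1` where `max_i |x_i| ≤ 1` and `0` where `max_i |x_i| ≥ 3/2`. -/
structure IsIsotropicGenerator (d : ℕ) (ψ₀ : Rd d → ℂ) : Prop where
  smooth : ContDiff ℝ ∞ ψ₀
  eq_one : ∀ x : Rd d, (∀ i, |x i| ≤ 1) → ψ₀ x = 1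
  eq_zero : ∀ x : Rd d, (∃ i, 3 / 2 ≤ |x i|) → ψ₀ x = 0

/-- Generator of a smooth dyadic decomposition of unity on `ℝ`: a smooth function which is `1` on
`[-1, 1]` and has its support in `[-3/2, 3/2]`. -/
structure IsUnivariateGenerator (φ₀ : ℝ → ℂ) : Prop where
  smooth : ContDiff ℝ ∞ φ₀
  eq_one : ∀ x ∈ Set.Icc (-1 : ℝ) 1, φ₀ x = 1
  support_subset : tsupport φ₀ ⊆ Set.Icc (-(3 / 2) : ℝ) (3 / 2)

/-- The dyadic decomposition generated by `η`: `η_0 = η` and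
`η_j (x) = η (2^{-j} x) - η (2^{-j+1} x)` for `j ≥ 1`. -/
def dyadicBlock {E : Type*} [SMul ℝ E] (η : E → ℂ) : ℕ → E → ℂ
  | 0 => η
  | j + 1 => fun x => η (((2 : ℝ) ^ (j + 1))⁻¹ • x) - η (((2 : ℝ) ^ j)⁻¹ • x)

/-- The tensor product `φ_k (x) = φ_{k_1} (x_1) ⋯ φ_{k_d} (x_d)`, for `k ∈ ℕ_0^d`. -/
def tensorBlock {d : ℕ} (φ₀ : ℝ → ℂ) (k : Fin d → ℕ) (x : Rd d) : ℂ :=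
  ∏ i, dyadicBlock φ₀ (k i) (x i)

/-- The operator `f ↦ F⁻¹ [σ F f]` on tempered distributions, where
`F g (ξ) = (2π)^{-d/2} ∫ e^{i x ξ} g (x) dx`.
Mathlib's transform is `𝓕 g (η) = ∫ e^{-2 π i x η} g (x) dx`, so that
`F g (-2 π η) = (2π)^{-d/2} 𝓕 g (η)`; the substitution `ξ = -2 π η` turns multiplication by `σ (ξ)`
on the side of `F` into multiplication by `σ (-2 π η)` on the side of `𝓕`. -/
def fourierLocalize {d : ℕ} (σ : Rd d → ℂ) (f : 𝓢'(Rd d, ℂ)) : 𝓢'(Rd d, ℂ) :=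
  TemperedDistribution.fourierMultiplierCLM ℂ (fun η => σ ((-(2 * Real.pi)) • η)) f

/-- The tempered distribution `T` is given by the function `g`. -/
def IsRepresentedBy {d : ℕ} (T : 𝓢'(Rd d, ℂ)) (g : Rd d → ℂ) : Prop :=
  ∀ θ : 𝓢(Rd d, ℂ), Integrable (fun x => θ x * g x) ∧ T θ = ∫ x, θ x * g x

/-- The `L_p` quasi-norm of a tempered distribution, `0 < p ≤ ∞`: the quasi-norm
of the function which represents it (this function is unique up to null sets), and `∞` if there
is no such function. -/
def distLpNorm {d : ℕ} (p : ℝ≥0∞) (T : 𝓢'(Rd d, ℂ)) : ℝ≥0∞ :=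
  ⨅ (g : Rd d → ℂ) (_ : IsRepresentedBy T g), eLpNorm g p volume

/-- The `ℓ_q` quasi-norm of a family of elements of `[0, ∞]`, `0 < q ≤ ∞`. -/
def ellNorm {I : Type*} (q : ℝ≥0∞) (a : I → ℝ≥0∞) : ℝ≥0∞ :=
  if q = ⊤ then ⨆ i, a i else (∑' i, a i ^ q.toReal) ^ (1 / q.toReal)

/-- The quasi-norm of the isotropic Besov space `B^t_{p,q}(ℝ^d)`. -/
def isotropicNorm {d : ℕ} (ψ₀ : Rd d → ℂ) (t : ℝ) (p q : ℝ≥0∞) (f : 𝓢'(Rd d, ℂ)) : ℝ≥0∞ :=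
  ellNorm q fun j : ℕ =>
    (2 : ℝ≥0∞) ^ ((j : ℝ) * t) * distLpNorm p (fourierLocalize (dyadicBlock ψ₀ j) f)

/-- The quasi-norm of the Besov space of dominating mixed smoothness `S^t_{p,q}B(ℝ^d)`. -/
def mixedNorm {d : ℕ} (φ₀ : ℝ → ℂ) (t : ℝ) (p q : ℝ≥0∞) (f : 𝓢'(Rd d, ℂ)) : ℝ≥0∞ :=
  ellNorm q fun k : Fin d → ℕ =>
    (2 : ℝ≥0∞) ^ (((∑ i, k i : ℕ) : ℝ) * t) * distLpNorm p (fourierLocalize (tensorBlock φ₀ k) f)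

/-- The space of all tempered distributions with finite quasi-norm. -/
def finiteSpace {d : ℕ} (N : 𝓢'(Rd d, ℂ) → ℝ≥0∞) : Set 𝓢'(Rd d, ℂ) :=
  {f | N f < ⊤}

/-- Continuous embedding `X ↪ Y` of the spaces `X`, `Y` of tempered distributions with the
quasi-norms `N`, `M`: `X` is contained in `Y` and the inclusion is bounded. -/
def ContinuouslyEmbeds {d : ℕ} (N M : 𝓢'(Rd d, ℂ) → ℝ≥0∞) : Prop :=
  finiteSpace N ⊆ finiteSpace M ∧ ∃ C : ℝ≥0, ∀ f ∈ finiteSpace N, M f ≤ C * N f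

end BesovComparison

end

noncomputable section

namespace BesovComparison

open FourierTransform

/-! Modulation by a character translates the spectrum and leaves the `L_p` quasi-norm unchanged. For
`f` in the source space, modulate each dyadic piece `f_j`, `j < N`, so that its spectrum, contained
in the cube `|x_i| < (3/2) 2^j`, moves along the diagonal into `(12 ⋅ 2^j, 16 ⋅ 2^j)^d`. There the
isotropic block of index `j + 4` and the tensor block of index `(j + 4, …, j + 4)` equal `1`, and
all other blocks of either kind vanish. The sum `g_N` of the moved pieces thus has isotropic
quasi-norm at most `2^{4 t₀}` times that of `f` (`isotropicNorm_shiftedPartialSum_le`). On the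
diagonal `|k| = d (j + 4)`, so its mixed quasi-norm controls the `B^{td}_{p,q}` quasi-norm of `f`
truncated at `N` (`ellNorm_truncation_le_mixedNorm`). Apply the assumed embedding to `g_N` and let
`N → ∞`; the constants do not depend on `N`. -/

/-! ### Characters and modulation of tempered distributions. -/

lemma hasTemperateGrowth_cexp_mul_I :
    (fun s : ℝ => Complex.exp (s * Complex.I)).HasTemperateGrowth := by
  have key : ∀ (n : ℕ), iteratedDeriv n (fun s : ℝ => Complex.exp (s * Complex.I)) =
      fun s : ℝ => Complex.I ^ n * Complex.exp (s * Complex.I) := by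
    intro n
    induction n with
    | zero => simp
    | succ n ih =>
      rw [iteratedDeriv_succ, ih]
      funext s
      have h1 : HasDerivAt (fun s : ℝ => (s : ℂ) * Complex.I) Complex.I s := by
        simpa using (Complex.ofRealCLM.hasDerivAt (x := s)).mul_const Complex.I
      rw [((h1.cexp).const_mul (Complex.I ^ n)).deriv]
      ring
  refine ⟨(Complex.ofRealCLM.contDiff.mul contDiff_const).cexp, fun n => ⟨0, 1, fun x => ?_⟩⟩
  rw [norm_iteratedFDeriv_eq_norm_iteratedDeriv, key]
  simp [Complex.norm_exp_ofReal_mul_I]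

variable {d : ℕ}

/-- The character `x ↦ e^{2 π i x a}`. -/
def character (a x : Rd d) : ℂ := Complex.exp (((2 * Real.pi * inner ℝ x a : ℝ) : ℂ) * Complex.I)

lemma hasTemperateGrowth_character (a : Rd d) : (character a).HasTemperateGrowth := by
  have h : (fun x : Rd d => 2 * Real.pi * inner ℝ x a).HasTemperateGrowth := by fun_prop
  exact hasTemperateGrowth_cexp_mul_I.comp h

lemma norm_character (a x : Rd d) : ‖character a x‖ = 1 := Complex.norm_exp_ofReal_mul_I _

lemma character_mul_character_neg (a x : Rd d) : character (-a) x * character a x = 1 := by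
  rw [character, character, ← Complex.exp_add, ← add_mul, ← Complex.ofReal_add, inner_neg_right]
  simp

lemma character_eq_fourierChar (a x : Rd d) :
    character a x = (Real.fourierChar (inner ℝ x a) : ℂ) := by
  rw [Real.fourierChar_apply, character]

/-- Multiplication of a tempered distribution by the character `x ↦ e^{2 π i x a}`. -/
def modulate (a : Rd d) : 𝓢'(Rd d, ℂ) →L[ℂ] 𝓢'(Rd d, ℂ) :=
  TemperedDistribution.smulLeftCLM ℂ (character a)

lemma modulate_apply_apply (a : Rd d) (T : 𝓢'(Rd d, ℂ)) (u : 𝓢(Rd d, ℂ)) :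
    modulate a T u = T (SchwartzMap.smulLeftCLM ℂ (character a) u) := rfl

lemma modulate_neg_modulate (a : Rd d) (T : 𝓢'(Rd d, ℂ)) : modulate (-a) (modulate a T) = T := by
  rw [modulate, modulate, TemperedDistribution.smulLeftCLM_smulLeftCLM_apply
    (hasTemperateGrowth_character a) (hasTemperateGrowth_character (-a))]
  have : (character a * character (-a) : Rd d → ℂ) = fun _ => 1 := by
    funext x
    rw [Pi.mul_apply, mul_comm, character_mul_character_neg]
  rw [this, TemperedDistribution.smulLeftCLM_const, one_smul]

lemma fourierInv_character_smul (a : Rd d) (u : 𝓢(Rd d, ℂ)) (η : Rd d) :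
    𝓕⁻ (SchwartzMap.smulLeftCLM ℂ (character a) u) η = 𝓕⁻ u (η + a) := by
  rw [SchwartzMap.fourierInv_coe, SchwartzMap.fourierInv_coe, Real.fourierInv_eq, Real.fourierInv_eq]
  congr 1
  funext x
  rw [SchwartzMap.smulLeftCLM_apply_apply (hasTemperateGrowth_character a), inner_add_right,
    AddChar.map_add_eq_mul, mul_smul, character_eq_fourierChar]
  rfl

lemma fourier_comp_add_right (a : Rd d) {u v : 𝓢(Rd d, ℂ)} (h : ∀ η, v η = u (η + a)) (x : Rd d) :
    𝓕 v x = character a x * 𝓕 u x := by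
  rw [SchwartzMap.fourier_coe, SchwartzMap.fourier_coe, Real.fourier_eq, Real.fourier_eq,
    ← integral_add_right_eq_self (fun w => Real.fourierChar (-inner ℝ w x) • u w) a,
    ← integral_const_mul]
  congr 1
  funext η
  rw [h, character_eq_fourierChar, inner_add_left, neg_add, AddChar.map_add_eq_mul, mul_smul,
    real_inner_comm a x, Circle.smul_def, Circle.smul_def, Circle.smul_def, smul_eq_mul,
    smul_eq_mul, smul_eq_mul, mul_left_comm]
  -- The translation of the integration variable produces a phase that cancels the character.
  have h1 : (Real.fourierChar (inner ℝ a x) : ℂ) * Real.fourierChar (-inner ℝ a x) = 1 := by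
    rw [AddChar.map_neg_eq_inv, Circle.coe_inv, mul_inv_cancel₀ (Circle.coe_ne_zero _)]
  refine congrArg (_ * ·) ?_
  exact (by rw [← mul_assoc, h1, one_mul] :
    u (η + a) = (Real.fourierChar (inner ℝ a x) : ℂ) *
      ((Real.fourierChar (-inner ℝ a x) : ℂ) * u (η + a)))

/-- By duality this reduces to test functions: the character translates the inverse Fourier
transform by `a`, and transforming the translate back restores the character. -/
lemma fourierMultiplierCLM_modulate {m : Rd d → ℂ} (hm : m.HasTemperateGrowth) (a : Rd d)
    (f : 𝓢'(Rd d, ℂ)) :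
    TemperedDistribution.fourierMultiplierCLM ℂ m (modulate a f) =
      modulate a (TemperedDistribution.fourierMultiplierCLM ℂ (fun η => m (η + a)) f) := by
  have hm' : (fun η => m (η + a)).HasTemperateGrowth :=
    hm.comp (f := fun η => η + a) (by fun_prop)
  ext u
  rw [modulate_apply_apply, TemperedDistribution.fourierMultiplierCLM_apply_apply,
    TemperedDistribution.fourierMultiplierCLM_apply_apply, modulate_apply_apply]
  congr 1
  ext x
  rw [SchwartzMap.smulLeftCLM_apply_apply (hasTemperateGrowth_character a), smul_eq_mul]
  refine (fourier_comp_add_right a (fun η => ?_) x).symm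
  rw [SchwartzMap.smulLeftCLM_apply_apply hm', SchwartzMap.smulLeftCLM_apply_apply hm,
    fourierInv_character_smul]

lemma IsRepresentedBy.modulate {T : 𝓢'(Rd d, ℂ)} {g : Rd d → ℂ} (h : IsRepresentedBy T g)
    (a : Rd d) : IsRepresentedBy (modulate a T) (fun x => character a x * g x) := by
  intro θ
  have := h (SchwartzMap.smulLeftCLM ℂ (character a) θ)
  simp only [SchwartzMap.smulLeftCLM_apply_apply (hasTemperateGrowth_character a),
    smul_eq_mul] at this
  have e : (fun x => θ x * (character a x * g x)) = fun x => character a x * θ x * g x := by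
    funext x; ring
  rw [e]
  exact this

lemma distLpNorm_modulate_le (p : ℝ≥0∞) (a : Rd d) (T : 𝓢'(Rd d, ℂ)) :
    distLpNorm p (modulate a T) ≤ distLpNorm p T := by
  refine le_iInf₂ fun g hg => (iInf₂_le _ (hg.modulate a)).trans_eq ?_
  exact eLpNorm_congr_norm_ae (.of_forall fun x => by rw [norm_mul, norm_character, one_mul])

lemma distLpNorm_modulate (p : ℝ≥0∞) (a : Rd d) (T : 𝓢'(Rd d, ℂ)) :
    distLpNorm p (modulate a T) = distLpNorm p T := by
  refine (distLpNorm_modulate_le p a T).antisymm ?_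
  -- The opposite modulation is the inverse, so the one-sided bound applies in both directions.
  simpa only [modulate_neg_modulate] using distLpNorm_modulate_le p (-a) (modulate a T)

lemma distLpNorm_zero (p : ℝ≥0∞) : distLpNorm p (0 : 𝓢'(Rd d, ℂ)) = 0 := by
  refine le_antisymm ((iInf₂_le (0 : Rd d → ℂ) fun θ => ?_).trans_eq eLpNorm_zero) (zero_le)
  simp

/-! ### Sequence quasi-norms. -/

lemma ellNorm_le_ellNorm_comp {I J : Type*} {q : ℝ≥0∞} (hq : 0 < q) {ι : J → I}
    (hι : ι.Injective) {a : I → ℝ≥0∞} (ha : ∀ i ∉ Set.range ι, a i = 0) :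
    ellNorm q a ≤ ellNorm q (a ∘ ι) := by
  unfold ellNorm
  split_ifs with h
  · refine iSup_le fun i => ?_
    by_cases hi : i ∈ Set.range ι
    · obtain ⟨j, rfl⟩ := hi
      exact le_iSup (a ∘ ι) j
    · simp [ha i hi]
  · have hq' : 0 < q.toReal := ENNReal.toReal_pos hq.ne' h
    gcongr
    rw [← hι.tsum_eq]
    · rfl
    · intro i hi
      by_contra hc
      -- Positivity of the exponent makes `0 ^ q.toReal = 0`.
      exact hi (by simp [ha i hc, hq'])

lemma ellNorm_comp_le {I J : Type*} (q : ℝ≥0∞) {ι : J → I} (hι : ι.Injective) (a : I → ℝ≥0∞) :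
    ellNorm q (a ∘ ι) ≤ ellNorm q a := by
  unfold ellNorm
  split_ifs with h
  · exact iSup_comp_le a ι
  · gcongr
    exact ENNReal.tsum_comp_le_tsum_of_injective hι _

lemma ellNorm_mono {I : Type*} (q : ℝ≥0∞) {a b : I → ℝ≥0∞} (h : ∀ i, a i ≤ b i) :
    ellNorm q a ≤ ellNorm q b := by
  unfold ellNorm
  split_ifs
  · exact iSup_mono h
  · gcongr
    exact h _

lemma ellNorm_const_mul {I : Type*} {q : ℝ≥0∞} (hq : 0 < q) (c : ℝ≥0∞) (a : I → ℝ≥0∞) :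
    ellNorm q (fun i => c * a i) = c * ellNorm q a := by
  unfold ellNorm
  split_ifs with h
  · rw [ENNReal.mul_iSup]
  · have hq' : 0 < q.toReal := ENNReal.toReal_pos hq.ne' h
    simp_rw [ENNReal.mul_rpow_of_nonneg _ _ hq'.le, ENNReal.tsum_mul_left]
    rw [ENNReal.mul_rpow_of_nonneg _ _ (by positivity), ← ENNReal.rpow_mul,
      mul_one_div_cancel hq'.ne', ENNReal.rpow_one]

/-- This replaces a passage to the limit: uniform bounds on finite sums suffice, and no convergence
of the modulated series is needed. -/
lemma ellNorm_le_of_truncations {q : ℝ≥0∞} (hq : 0 < q) {a : ℕ → ℝ≥0∞} {X : ℝ≥0∞}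
    (h : ∀ N, ellNorm q (fun j => if j < N then a j else 0) ≤ X) : ellNorm q a ≤ X := by
  unfold ellNorm at *
  split_ifs at * with hqt
  · refine iSup_le fun j => ?_
    simpa using (le_iSup _ j).trans (h (j + 1))
  · have hq' : 0 < q.toReal := ENNReal.toReal_pos hq.ne' hqt
    rw [one_div, ENNReal.rpow_inv_le_iff hq', ENNReal.tsum_eq_iSup_nat]
    refine iSup_le fun N => ?_
    have := h N
    rw [one_div, ENNReal.rpow_inv_le_iff hq'] at this
    refine le_trans ?_ ((ENNReal.sum_le_tsum (Finset.range N)).trans this)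
    refine Finset.sum_le_sum fun j hj => ?_
    simp [Finset.mem_range.1 hj]

/-! ### Dyadic and tensor blocks, and their values on the shifted cubes. -/

lemma _root_.Function.HasTemperateGrowth.finsetProd {ι E : Type*} [NormedAddCommGroup E]
    [NormedSpace ℝ E] {f : ι → E → ℂ} (s : Finset ι) (hf : ∀ i, (f i).HasTemperateGrowth) :
    (fun x => ∏ i ∈ s, f i x).HasTemperateGrowth := by
  classical
  induction s using Finset.induction_on with
  | empty => simp
  | insert a s has ih =>
    simp_rw [Finset.prod_insert has]
    exact (hf a).mul ih

lemma hasTemperateGrowth_dyadicBlock {E : Type*} [NormedAddCommGroup E] [NormedSpace ℝ E]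
    {η : E → ℂ} (h : η.HasTemperateGrowth) (j : ℕ) : (dyadicBlock η j).HasTemperateGrowth := by
  cases j with
  | zero => exact h
  | succ j =>
    have (c : ℝ) : (fun x => η (c • x)).HasTemperateGrowth :=
      h.comp (f := fun x => c • x) (by fun_prop)
    exact (this _).sub (this _)

lemma IsUnivariateGenerator.hasTemperateGrowth {φ₀ : ℝ → ℂ} (h : IsUnivariateGenerator φ₀) :
    φ₀.HasTemperateGrowth :=
  HasCompactSupport.hasTemperateGrowth
    (isCompact_Icc.of_isClosed_subset (isClosed_tsupport _) h.support_subset) h.smooth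

lemma IsUnivariateGenerator.eq_zero {φ₀ : ℝ → ℂ} (h : IsUnivariateGenerator φ₀) {x : ℝ}
    (hx : 3 / 2 < x) : φ₀ x = 0 := by
  by_contra hc
  have := (h.support_subset (subset_tsupport _ hc)).2
  linarith

lemma IsIsotropicGenerator.hasTemperateGrowth {ψ₀ : Rd d → ℂ} (h : IsIsotropicGenerator d ψ₀) :
    ψ₀.HasTemperateGrowth := by
  refine HasCompactSupport.hasTemperateGrowth ?_ h.smooth
  refine HasCompactSupport.intro (K := (EuclideanSpace.equiv (Fin d) ℝ).symm ''
    (Set.Icc (fun _ => -(3 / 2)) (fun _ => 3 / 2)))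
    (isCompact_Icc.image (EuclideanSpace.equiv (Fin d) ℝ).symm.continuous) fun x hx => ?_
  refine h.eq_zero x ?_
  by_contra! hc
  exact hx ⟨EuclideanSpace.equiv (Fin d) ℝ x, ⟨fun i => (abs_le.1 (hc i).le).1,
    fun i => (abs_le.1 (hc i).le).2⟩, by simp⟩

lemma hasTemperateGrowth_tensorBlock {φ₀ : ℝ → ℂ} (h : IsUnivariateGenerator φ₀)
    (k : Fin d → ℕ) : (tensorBlock (d := d) φ₀ k).HasTemperateGrowth := by
  refine Function.HasTemperateGrowth.finsetProd Finset.univ fun i => ?_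
  exact (hasTemperateGrowth_dyadicBlock h.hasTemperateGrowth (k i)).comp
    (f := fun x : Rd d => x i) (EuclideanSpace.proj (𝕜 := ℝ) i).hasTemperateGrowth

/-- The dilates `η (2^{-l} y)` are `0` for `l ≤ j + 3` and `1` for `l ≥ j + 4`, so consecutive
differences see a single jump. Stating the hypotheses along the ray through `y` lets the lemma serve
both generators. -/
lemma dyadicBlock_eq_ite {E : Type*} [NormedAddCommGroup E] [NormedSpace ℝ E] {η : E → ℂ} {y : E}
    {j : ℕ} (h1 : ∀ c : ℝ, 0 < c → c ≤ ((2 : ℝ) ^ (j + 4))⁻¹ → η (c • y) = 1)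
    (h0 : ∀ c : ℝ, ((2 : ℝ) ^ (j + 3))⁻¹ ≤ c → η (c • y) = 0) (k : ℕ) :
    dyadicBlock η k y = if k = j + 4 then 1 else 0 := by
  have large : ∀ l, j + 4 ≤ l → η (((2 : ℝ) ^ l)⁻¹ • y) = 1 := fun l hl =>
    h1 _ (by positivity) (by gcongr; norm_num)
  have small : ∀ l, l ≤ j + 3 → η (((2 : ℝ) ^ l)⁻¹ • y) = 0 := fun l hl =>
    h0 _ (by gcongr; norm_num)
  cases k with
  | zero => simpa [dyadicBlock] using small 0 (by omega)
  | succ k =>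
    change η (((2 : ℝ) ^ (k + 1))⁻¹ • y) - η (((2 : ℝ) ^ k)⁻¹ • y) = _
    rcases lt_trichotomy k (j + 3) with hk | rfl | hk
    · rw [small (k + 1) hk, small k hk.le, if_neg (by omega), sub_zero]
    · rw [large (j + 3 + 1) le_rfl, small (j + 3) le_rfl, if_pos rfl, sub_zero]
    · rw [large (k + 1) (by omega), large k hk, if_neg (by omega), sub_self]

/-- The vector `(14 ⋅ 2^j, …, 14 ⋅ 2^j)`. -/
def diagonalShift (d j : ℕ) : Rd d := WithLp.toLp 2 fun _ => 14 * 2 ^ j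

lemma IsIsotropicGenerator.abs_lt_of_dyadicBlock_ne_zero {ψ₀ : Rd d → ℂ}
    (h : IsIsotropicGenerator d ψ₀) {j : ℕ} {x : Rd d} (hx : dyadicBlock ψ₀ j x ≠ 0) (i : Fin d) :
    |x i| < 3 / 2 * 2 ^ j := by
  by_contra! hc
  have key : ∀ l ≤ j, ψ₀ (((2 : ℝ) ^ l)⁻¹ • x) = 0 := fun l hl => by
    refine h.eq_zero _ ⟨i, ?_⟩
    have hl' : (2 : ℝ) ^ l ≤ 2 ^ j := pow_le_pow_right₀ (by norm_num) hl
    rw [PiLp.smul_apply, smul_eq_mul, abs_mul, abs_inv, abs_of_pos (by positivity : (0:ℝ) < 2 ^ l),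
      le_inv_mul_iff₀ (by positivity)]
    linarith
  apply hx
  cases j with
  | zero => simpa [dyadicBlock] using key 0 le_rfl
  | succ j =>
    change ψ₀ (((2 : ℝ) ^ (j + 1))⁻¹ • x) - ψ₀ (((2 : ℝ) ^ j)⁻¹ • x) = 0
    rw [key _ le_rfl, key _ j.le_succ, sub_zero]

lemma IsIsotropicGenerator.mem_Ioo_of_dyadicBlock_ne_zero {ψ₀ : Rd d → ℂ}
    (h : IsIsotropicGenerator d ψ₀) {j : ℕ} {x : Rd d} (hx : dyadicBlock ψ₀ j x ≠ 0) (i : Fin d) :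
    (x + diagonalShift d j) i ∈ Set.Ioo (3 / 2 * (2 : ℝ) ^ (j + 3)) (2 ^ (j + 4)) := by
  have := abs_lt.1 (h.abs_lt_of_dyadicBlock_ne_zero hx i)
  have e : (x + diagonalShift d j) i = x i + 14 * 2 ^ j := rfl
  have h2 : (0 : ℝ) < 2 ^ j := by positivity
  -- The shifted coordinate lies within `(3/2) 2^j` of `14 ⋅ 2^j`, hence between `12 ⋅ 2^j` and `16
  -- ⋅ 2^j`, which are the two endpoints.
  rw [e, pow_add, pow_add]
  constructor <;> linarith [this.1, this.2]

lemma mul_le_one_of_mem_Ioo {j : ℕ} {s c : ℝ}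
    (hs : s ∈ Set.Ioo (3 / 2 * (2 : ℝ) ^ (j + 3)) (2 ^ (j + 4))) (hc : 0 < c)
    (hc' : c ≤ ((2 : ℝ) ^ (j + 4))⁻¹) : 0 ≤ c * s ∧ c * s ≤ 1 := by
  have hs0 : 0 < s := lt_trans (by positivity) hs.1
  refine ⟨by positivity, (mul_le_mul hc' hs.2.le hs0.le (by positivity)).trans_eq ?_⟩
  exact inv_mul_cancel₀ (by positivity)

lemma lt_mul_of_mem_Ioo {j : ℕ} {s c : ℝ}
    (hs : s ∈ Set.Ioo (3 / 2 * (2 : ℝ) ^ (j + 3)) (2 ^ (j + 4)))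
    (hc : ((2 : ℝ) ^ (j + 3))⁻¹ ≤ c) : 3 / 2 < c * s := by
  have hs0 : 0 < s := lt_trans (by positivity) hs.1
  calc (3 / 2 : ℝ) = ((2 : ℝ) ^ (j + 3))⁻¹ * (3 / 2 * 2 ^ (j + 3)) := by field_simp
    _ < ((2 : ℝ) ^ (j + 3))⁻¹ * s := by gcongr; exact hs.1
    _ ≤ c * s := by gcongr

lemma dyadicBlock_add_diagonalShift (hd : 1 ≤ d) {ψ₀ : Rd d → ℂ}
    (h : IsIsotropicGenerator d ψ₀) {j : ℕ} {x : Rd d} (hx : dyadicBlock ψ₀ j x ≠ 0) (k : ℕ) :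
    dyadicBlock ψ₀ k (x + diagonalShift d j) = if k = j + 4 then 1 else 0 := by
  have hm := h.mem_Ioo_of_dyadicBlock_ne_zero hx
  refine dyadicBlock_eq_ite (fun c hc hc' => h.eq_one _ fun i => ?_)
    (fun c hc => h.eq_zero _ ⟨⟨0, hd⟩, ?_⟩) k
  · obtain ⟨h1, h2⟩ := mul_le_one_of_mem_Ioo (hm i) hc hc'
    rwa [PiLp.smul_apply, smul_eq_mul, abs_of_nonneg h1]
  · exact (lt_mul_of_mem_Ioo (hm _) hc).le.trans (le_abs_self _)

/-- All coordinates of the shifted point lie in the same interval, so every factor selects the same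
index `j + 4`. -/
lemma tensorBlock_add_diagonalShift {ψ₀ : Rd d → ℂ} (h : IsIsotropicGenerator d ψ₀)
    {φ₀ : ℝ → ℂ} (hφ : IsUnivariateGenerator φ₀) {j : ℕ} {x : Rd d}
    (hx : dyadicBlock ψ₀ j x ≠ 0) (k : Fin d → ℕ) :
    tensorBlock φ₀ k (x + diagonalShift d j) = if k = (fun _ => j + 4) then 1 else 0 := by
  have hm := h.mem_Ioo_of_dyadicBlock_ne_zero hx
  have e : ∀ i, dyadicBlock φ₀ (k i) ((x + diagonalShift d j) i) =
      if k i = j + 4 then 1 else 0 := fun i => by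
    refine dyadicBlock_eq_ite (fun c hc hc' => hφ.eq_one _ ?_)
      (fun c hc => hφ.eq_zero (lt_mul_of_mem_Ioo (hm i) hc)) _
    obtain ⟨h1, h2⟩ := mul_le_one_of_mem_Ioo (hm i) hc hc'
    exact ⟨by rw [smul_eq_mul]; linarith, h2⟩
  simp_rw [tensorBlock, e]
  split_ifs with hk
  · simp [hk]
  · obtain ⟨i, hi⟩ := Function.ne_iff.1 hk
    exact Finset.prod_eq_zero (Finset.mem_univ i) (if_neg hi)

/-! ### Frequency shifts and the shifted partial sums. -/

/-- The multiplication by a character which shifts the Fourier transform by `b`, in the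
normalization of `fourierLocalize`. -/
def frequencyShift (b : Rd d) : 𝓢'(Rd d, ℂ) →L[ℂ] 𝓢'(Rd d, ℂ) :=
  modulate (-(2 * Real.pi)⁻¹ • b)

lemma fourierLocalize_frequencyShift_fourierLocalize {σ τ : Rd d → ℂ}
    (hσ : σ.HasTemperateGrowth) (hτ : τ.HasTemperateGrowth) (b : Rd d) (f : 𝓢'(Rd d, ℂ)) :
    fourierLocalize σ (frequencyShift b (fourierLocalize τ f)) =
      frequencyShift b (fourierLocalize (fun ξ => τ ξ * σ (ξ + b)) f) := by
  have hlin : (fun η : Rd d => (-(2 * Real.pi)) • η).HasTemperateGrowth := by fun_prop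
  have hσ' : (fun η : Rd d => σ ((-(2 * Real.pi)) • η)).HasTemperateGrowth := hσ.comp hlin
  have hτ' : (fun η : Rd d => τ ((-(2 * Real.pi)) • η)).HasTemperateGrowth := hτ.comp hlin
  have e : (fun η : Rd d => σ ((-(2 * Real.pi)) • (η + -(2 * Real.pi)⁻¹ • b))) =
      fun η => σ ((-(2 * Real.pi)) • η + b) := by
    funext η
    -- The factor `-(2π)⁻¹` in `frequencyShift` undoes the rescaling by `-2π` in `fourierLocalize`.
    rw [smul_add, smul_smul, neg_mul_neg, mul_inv_cancel₀ (by positivity), one_smul]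
  rw [fourierLocalize, frequencyShift, fourierMultiplierCLM_modulate hσ', e, fourierLocalize,
    TemperedDistribution.fourierMultiplierCLM_fourierMultiplierCLM_apply hτ']
  · rfl
  · exact hσ.comp (f := fun η : Rd d => (-(2 * Real.pi)) • η + b) (by fun_prop)

lemma fourierLocalize_zero (f : 𝓢'(Rd d, ℂ)) : fourierLocalize (fun _ => 0) f = 0 := by
  simp [fourierLocalize]

lemma fourierLocalize_sum (σ : Rd d → ℂ) {ι : Type*} (s : Finset ι) (f : ι → 𝓢'(Rd d, ℂ)) :
    fourierLocalize σ (∑ j ∈ s, f j) = ∑ j ∈ s, fourierLocalize σ (f j) :=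
  map_sum _ _ _

/-- The dyadic pieces of `f` of order less than `N`, shifted in frequency along the diagonal. -/
def shiftedPartialSum (ψ₀ : Rd d → ℂ) (N : ℕ) (f : 𝓢'(Rd d, ℂ)) : 𝓢'(Rd d, ℂ) :=
  ∑ j ∈ Finset.range N,
    frequencyShift (diagonalShift d j) (fourierLocalize (dyadicBlock ψ₀ j) f)

/-- The predicate `P` records which pieces `σ` keeps; where the block vanishes the value of `σ` is
irrelevant. It is applied with `σ` an isotropic block and with `σ` a tensor block. -/
lemma fourierLocalize_shiftedPartialSum {ψ₀ : Rd d → ℂ} (h : IsIsotropicGenerator d ψ₀)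
    {σ : Rd d → ℂ} (hσ : σ.HasTemperateGrowth) (P : ℕ → Prop) [DecidablePred P]
    (hP : ∀ j x, dyadicBlock ψ₀ j x ≠ 0 → σ (x + diagonalShift d j) = if P j then 1 else 0)
    (N : ℕ) (f : 𝓢'(Rd d, ℂ)) :
    fourierLocalize σ (shiftedPartialSum ψ₀ N f) =
      ∑ j ∈ Finset.range N, if P j then
        frequencyShift (diagonalShift d j) (fourierLocalize (dyadicBlock ψ₀ j) f) else 0 := by
  rw [shiftedPartialSum, fourierLocalize_sum]
  refine Finset.sum_congr rfl fun j _ => ?_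
  rw [fourierLocalize_frequencyShift_fourierLocalize hσ
    (hasTemperateGrowth_dyadicBlock h.hasTemperateGrowth j)]
  have e : (fun ξ => dyadicBlock ψ₀ j ξ * σ (ξ + diagonalShift d j)) =
      if P j then dyadicBlock ψ₀ j else fun _ => 0 := by
    funext ξ
    by_cases h0 : dyadicBlock ψ₀ j ξ = 0
    · split_ifs <;> simp [h0]
    · rw [hP j ξ h0]
      split_ifs <;> simp
  rw [e]
  split_ifs
  · rfl
  · rw [fourierLocalize_zero, map_zero]

lemma distLpNorm_fourierLocalize_dyadicBlock_shiftedPartialSum (hd : 1 ≤ d) {ψ₀ : Rd d → ℂ}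
    (h : IsIsotropicGenerator d ψ₀) (p : ℝ≥0∞) (N k : ℕ) (f : 𝓢'(Rd d, ℂ)) :
    distLpNorm p (fourierLocalize (dyadicBlock ψ₀ k) (shiftedPartialSum ψ₀ N f)) =
      if 4 ≤ k ∧ k < N + 4 then
        distLpNorm p (fourierLocalize (dyadicBlock ψ₀ (k - 4)) f) else 0 := by
  rw [fourierLocalize_shiftedPartialSum h (hasTemperateGrowth_dyadicBlock h.hasTemperateGrowth k)
    (fun j => k = j + 4) (fun j x hx => dyadicBlock_add_diagonalShift hd h hx k)]
  split_ifs with hk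
  · obtain ⟨j, rfl⟩ := Nat.exists_eq_add_of_le' hk.1
    rw [Finset.sum_eq_single j, if_pos rfl, frequencyShift, distLpNorm_modulate,
      Nat.add_sub_cancel]
    · exact fun i _ hi => if_neg (by omega)
    · exact fun hj => absurd (Finset.mem_range.2 (by omega)) hj
  · rw [Finset.sum_eq_zero, distLpNorm_zero]
    intro j hj
    have := Finset.mem_range.1 hj
    exact if_neg (by omega)

lemma distLpNorm_fourierLocalize_tensorBlock_shiftedPartialSum (hd : 1 ≤ d) {ψ₀ : Rd d → ℂ}
    (h : IsIsotropicGenerator d ψ₀) {φ₀ : ℝ → ℂ} (hφ : IsUnivariateGenerator φ₀) (p : ℝ≥0∞)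
    {N j : ℕ} (hj : j < N) (f : 𝓢'(Rd d, ℂ)) :
    distLpNorm p (fourierLocalize (tensorBlock φ₀ fun _ => j + 4) (shiftedPartialSum ψ₀ N f)) =
      distLpNorm p (fourierLocalize (dyadicBlock ψ₀ j) f) := by
  rw [fourierLocalize_shiftedPartialSum h (hasTemperateGrowth_tensorBlock hφ _)
    (fun i => (fun _ : Fin d => j + 4) = fun _ => i + 4)
    (fun i x hx => tensorBlock_add_diagonalShift h hφ hx _)]
  rw [Finset.sum_eq_single j, if_pos rfl, frequencyShift, distLpNorm_modulate]
  · intro i _ hi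
    refine if_neg fun hc => ?_
    have := congrFun hc ⟨0, hd⟩
    omega
  · exact fun hj' => absurd (Finset.mem_range.2 hj) hj'

/-- Piece `j` now sits at index `j + 4`, so the weight grows by `2^{4t}`. -/
lemma isotropicNorm_shiftedPartialSum_le (hd : 1 ≤ d) {ψ₀ : Rd d → ℂ}
    (h : IsIsotropicGenerator d ψ₀) (t : ℝ) (p : ℝ≥0∞) {q : ℝ≥0∞} (hq : 0 < q) (N : ℕ)
    (f : 𝓢'(Rd d, ℂ)) :
    isotropicNorm ψ₀ t p q (shiftedPartialSum ψ₀ N f) ≤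
      (2 : ℝ≥0∞) ^ (4 * t) * isotropicNorm ψ₀ t p q f := by
  unfold isotropicNorm
  refine (ellNorm_le_ellNorm_comp hq (add_left_injective 4) fun k hk => ?_).trans ?_
  · rw [distLpNorm_fourierLocalize_dyadicBlock_shiftedPartialSum hd h, if_neg, mul_zero]
    exact fun hk' => hk ⟨k - 4, Nat.sub_add_cancel hk'.1⟩
  · rw [← ellNorm_const_mul hq]
    refine ellNorm_mono q fun j => ?_
    rw [Function.comp_apply, distLpNorm_fourierLocalize_dyadicBlock_shiftedPartialSum hd h,
      ← mul_assoc, ← ENNReal.rpow_add _ _ two_ne_zero ENNReal.ofNat_ne_top]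
    have e : ((j + 4 : ℕ) : ℝ) * t = 4 * t + j * t := by push_cast; ring
    rw [e, Nat.add_sub_cancel]
    split_ifs <;> simp

/-- Discarding all off-diagonal indices only lowers the mixed quasi-norm. The diagonal weight `2^{d
(j + 4) t}` is the origin of the smoothness `td`. -/
lemma ellNorm_truncation_le_mixedNorm (hd : 1 ≤ d) {ψ₀ : Rd d → ℂ}
    (h : IsIsotropicGenerator d ψ₀) {φ₀ : ℝ → ℂ} (hφ : IsUnivariateGenerator φ₀) (t : ℝ)
    (p : ℝ≥0∞) {q : ℝ≥0∞} (hq : 0 < q) (N : ℕ) (f : 𝓢'(Rd d, ℂ)) :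
    (2 : ℝ≥0∞) ^ (4 * (t * d)) * ellNorm q (fun j => if j < N then (2 : ℝ≥0∞) ^ ((j : ℝ) * (t * d)) *
        distLpNorm p (fourierLocalize (dyadicBlock ψ₀ j) f) else 0) ≤
      mixedNorm φ₀ t p q (shiftedPartialSum ψ₀ N f) := by
  unfold mixedNorm
  have hinj : (fun (j : ℕ) (_ : Fin d) => j + 4).Injective := fun i j hij => by
    simpa using congrFun hij ⟨0, hd⟩
  refine le_trans ?_ (ellNorm_comp_le q hinj _)
  rw [← ellNorm_const_mul hq]
  refine ellNorm_mono q fun j => ?_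
  split_ifs with hj
  · rw [Function.comp_apply, distLpNorm_fourierLocalize_tensorBlock_shiftedPartialSum hd h hφ p hj,
      ← mul_assoc, ← ENNReal.rpow_add _ _ two_ne_zero ENNReal.ofNat_ne_top]
    have e : ((∑ _i : Fin d, (j + 4) : ℕ) : ℝ) * t = 4 * (t * d) + j * (t * d) := by
      simp; ring
    rw [e]
  · simp

/-! ### Embeddings and the comparison. -/

lemma ContinuouslyEmbeds.trans {N M K : 𝓢'(Rd d, ℂ) → ℝ≥0∞} (h : ContinuouslyEmbeds N M)
    (h' : ContinuouslyEmbeds M K) : ContinuouslyEmbeds N K := by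
  obtain ⟨hs, C, hC⟩ := h
  obtain ⟨hs', C', hC'⟩ := h'
  refine ⟨hs.trans hs', C' * C, fun f hf => (hC' f (hs hf)).trans ?_⟩
  rw [ENNReal.coe_mul, mul_assoc]
  gcongr
  exact hC f hf

lemma continuouslyEmbeds_of_le {N M : 𝓢'(Rd d, ℂ) → ℝ≥0∞} {C : ℝ≥0∞} (hC : C ≠ ⊤)
    (h : ∀ f ∈ finiteSpace N, M f ≤ C * N f) : ContinuouslyEmbeds N M := by
  refine ⟨fun f hf => (h f hf).trans_lt (ENNReal.mul_lt_top hC.lt_top hf), C.toNNReal, ?_⟩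
  rwa [ENNReal.coe_toNNReal hC]

lemma continuouslyEmbeds_isotropicNorm_of_mixedNorm (hd : 1 ≤ d) {ψ₀ : Rd d → ℂ}
    (hψ₀ : IsIsotropicGenerator d ψ₀) {φ₀ : ℝ → ℂ} (hφ₀ : IsUnivariateGenerator φ₀)
    {p q p₀ q₀ : ℝ≥0∞} {t t₀ : ℝ} (hq : 0 < q) (hq₀ : 0 < q₀)
    (h : ContinuouslyEmbeds (isotropicNorm ψ₀ t₀ p₀ q₀) (mixedNorm φ₀ t p q)) :
    ContinuouslyEmbeds (isotropicNorm ψ₀ t₀ p₀ q₀) (isotropicNorm ψ₀ (t * d) p q) := by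
  obtain ⟨-, C, hC⟩ := h
  have two_rpow_ne_top (s : ℝ) : (2 : ℝ≥0∞) ^ s ≠ ⊤ :=
    ENNReal.rpow_ne_top_of_ne_zero two_ne_zero ENNReal.ofNat_ne_top
  refine continuouslyEmbeds_of_le (C := (2 : ℝ≥0∞) ^ (-(4 * (t * d))) * (C * 2 ^ (4 * t₀)))
    (ENNReal.mul_ne_top (two_rpow_ne_top _) (ENNReal.mul_ne_top ENNReal.coe_ne_top
      (two_rpow_ne_top _))) fun f hf => ellNorm_le_of_truncations hq fun N => ?_
  have hle := isotropicNorm_shiftedPartialSum_le hd hψ₀ t₀ p₀ hq₀ N f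
  -- The bound `hle` is used twice: it puts the shifted sum in the source space, and it then
  -- estimates its quasi-norm by that of `f`.
  have key := (ellNorm_truncation_le_mixedNorm hd hψ₀ hφ₀ t p hq N f).trans
    ((hC _ (hle.trans_lt (ENNReal.mul_lt_top (two_rpow_ne_top _).lt_top hf))).trans
      (mul_le_mul_right hle _))
  rw [mul_assoc, mul_assoc, ENNReal.rpow_neg, ← ENNReal.mul_le_iff_le_inv _ (two_rpow_ne_top _)]
  · exact key
  · exact (ENNReal.rpow_pos two_pos ENNReal.ofNat_ne_top).ne'

end BesovComparison
end

open BesovComparison in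
theorem theorem3p9 (d : ℕ) (hd : 1 ≤ d)
    (ψ₀ : Rd d → ℂ) (hψ₀ : IsIsotropicGenerator d ψ₀)
    (φ₀ : ℝ → ℂ) (hφ₀ : IsUnivariateGenerator φ₀)
    (p q : ℝ≥0∞) (hp : 0 < p) (hq : 0 < q) (t : ℝ) :
    -- every isotropic space of the family embeds into `B^{td}_{p,q}`
    (∀ (p₀ q₀ : ℝ≥0∞) (t₀ : ℝ), 0 < p₀ → 0 < q₀ →
      ContinuouslyEmbeds (isotropicNorm ψ₀ t₀ p₀ q₀) (mixedNorm φ₀ t p q) →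
      ContinuouslyEmbeds (isotropicNorm ψ₀ t₀ p₀ q₀) (isotropicNorm ψ₀ (t * d) p q)) ∧
    -- if `B^{td}_{p,q}` is in the family, the family is that of all spaces embedded into it
    (ContinuouslyEmbeds (isotropicNorm ψ₀ (t * d) p q) (mixedNorm φ₀ t p q) →
      ∀ (p₀ q₀ : ℝ≥0∞) (t₀ : ℝ), 0 < p₀ → 0 < q₀ →
        (ContinuouslyEmbeds (isotropicNorm ψ₀ t₀ p₀ q₀) (mixedNorm φ₀ t p q) ↔
          ContinuouslyEmbeds (isotropicNorm ψ₀ t₀ p₀ q₀) (isotropicNorm ψ₀ (t * d) p q))) :=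
  ⟨fun _ _ _ _ hq₀ h => continuouslyEmbeds_isotropicNorm_of_mixedNorm hd hψ₀ hφ₀ hq hq₀ h,
    fun hB _ _ _ _ hq₀ =>
      ⟨fun h => continuouslyEmbeds_isotropicNorm_of_mixedNorm hd hψ₀ hφ₀ hq hq₀ h,
        fun h => h.trans hB⟩⟩
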